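/- A category $\mathcal{C}$ is \emph{Gr\"obner} if for every object $c$: (G1) the sets $\mathrm{Hom}(c,d)$, for all $d$, can be endowed with well-orders $\prec_d$ such that $f\prec_d f'$ implies $g\circ f\prec_{e} g\circ f'$ for all $f,f':c\to d$ and $g:d\to e$; and (G2) for every sequence $f_1,f_2,\dots$ of morphisms with source $c$ there are $i<j$ and a morphism $h$ with $h\circ f_i=f_j$ (i.e. the poset $|c/\mathcal{C}|$ generated by the preorder "$f\le g$ iff $g=h\circ f$ for some $h$" on the morphisms from $c$ is Noetherian). A functor $\Phi:\mathcal{C}\to\mathcal{D}$ satisfies \emph{property (F)} if for every object $d$ of $\mathcal{D}$ there are finitely many objects $c_1,\dots,c_n$ of $\mathcal{C}$ and morphisms $f_i:d\to\Phi(c_i)$ such that every morphism $f:d\to\Phi(c)$, with $c$ in $\mathcal{C}$, equals $\Phi(g)\circ f_i$ for some $i$ and some $g:c_i\to c$. A category $\mathcal{D}$ is \emph{quasi-Gr\"obner} if there is an essentially surjective functor $\Phi:\mathcal{C}\to\mathcal{D}$ that satisfies property (F), with $\mathcal{C}$ a small Gr\"obner category. Let $pOp$ be the operad whose algebras are planar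 (non-symmetric) operads, and let $nupOp$ be its suboperad of operations of non-zero arity. The category $\mathcal{C}(nupOp)^{op}$ is the following one. Its objects are the operations of $nupOp$, i.e. planar operadic trees: planar rooted trees with half-edges (vertices with no inputs are allowed), with $n\ge 1$ vertices indexed by $1,\dots,n$ and with input leaves indexed in planar order. A morphism $p\to q$ is a presentation of $q$ as the result of inserting, for each vertex index $j$ of $p$, a planar operadic tree $q_j$ with at least one vertex, and with as many input leaves as the $j$-th vertex of $p$ has inputs, into the $j$-th vertex of $p$, so that the $i$-th input leaf of $q_j$ is connected to whatever the $i$-th input of that vertex was connected to; the vertices of the resulting tree $q$ are indexed by an arbitrary bijection with $1,\dots,m$ that restricts to an order-preserving map on the vertices of each $q_j$ (the bijection is part of the morphism). Morphisms are composed by inserting trees into the vertices of the inserted trees. \textbf{Theorem.} The category $\mathcal{C}(nupOp)^{op}$ is quasi-Gr\"obner. -/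

import Mathlib

open CategoryTheory

universe v u

/-! ## Gröbner and quasi-Gröbner categories -/

/-- An admissible order on the set of morphisms from `c`: a lift of the functor `Hom(c, -)` to the
category of well-orders and strictly order preserving maps. -/
structure AdmissibleOrder {C : Type u} [Category.{v} C] (c : C) where
  /-- the strict well-order on each set `Hom(c, d)` -/
  lt : ∀ d : C, (c ⟶ d) → (c ⟶ d) → Prop
  wellOrder : ∀ d : C, IsWellOrder (c ⟶ d) (lt d)
  strictMono : ∀ {d e : C} (g : d ⟶ e) (f f' : c ⟶ d), lt d f f' → lt e (f ≫ g) (f' ≫ g)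

/-- The morphisms of `C` with source `c` and arbitrary target. -/
structure MorphismFrom {C : Type u} [Category.{v} C] (c : C) where
  target : C
  hom : c ⟶ target

/-- The canonical preorder on the morphisms from `c`: `f ≤ g` if `g = h ∘ f` for some `h`. -/
instance MorphismFrom.instPreorder {C : Type u} [Category.{v} C] (c : C) :
    Preorder (MorphismFrom c) where
  le f g := ∃ h : f.target ⟶ g.target, f.hom ≫ h = g.hom
  le_refl f := ⟨𝟙 _, Category.comp_id _⟩
  le_trans f g k := by
    rintro ⟨a, ha⟩ ⟨b, hb⟩
    exact ⟨a ≫ b, by rw [← Category.assoc, ha, hb]⟩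

/-- The poset `|c/C|` generated by the canonical preorder on the morphisms from `c`. -/
abbrev UnderPoset {C : Type u} [Category.{v} C] (c : C) : Type (max u v) :=
  Antisymmetrization (MorphismFrom c) (fun f g => f ≤ g)

/-- A poset is Noetherian if every sequence `x` has indices `i < j` with `x i ≤ x j`. -/
def IsNoetherianPoset (X : Type u) [PartialOrder X] : Prop :=
  ∀ x : ℕ → X, ∃ i j : ℕ, i < j ∧ x i ≤ x j

/-- A category is Gröbner if, for every object `c`,
(G1) the set of morphisms from `c` can be endowed with an admissible order, and
(G2) the poset `|c/C|` is Noetherian. -/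
structure IsGrobner (C : Type u) [Category.{v} C] : Prop where
  g1 : ∀ c : C, Nonempty (AdmissibleOrder c)
  g2 : ∀ c : C, IsNoetherianPoset (UnderPoset c)

/-- Property (F) of a functor. -/
def PropertyF {C : Type*} [Category C] {D : Type*} [Category D] (Φ : C ⥤ D) : Prop :=
  ∀ d : D, ∃ (n : ℕ) (c : Fin n → C) (f : ∀ i, d ⟶ Φ.obj (c i)),
    ∀ (c' : C) (h : d ⟶ Φ.obj c'), ∃ (i : Fin n) (g : c i ⟶ c'), h = f i ≫ Φ.map g

/-- A category `D` is quasi-Gröbner if it admits an essentially surjective functor with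
property (F) from a small Gröbner category. -/
def IsQuasiGrobner (D : Type u) [Category.{v} D] : Prop :=
  ∃ (C : Type v) (_ : SmallCategory C) (Φ : C ⥤ D),
    IsGrobner C ∧ Φ.EssSurj ∧ PropertyF Φ

/-! ## Planar rooted trees with half-edges -/

/-- Planar rooted trees with half-edges. Vertices are marked by elements of `V`, a vertex marked by
`a` has `ar a` linearly ordered input half-edges, and the input leaves are marked by elements of
`X`. The tree `leaf x` is the trivial tree without vertices, i.e. an edge. -/
inductive HTree {V : Type} (ar : V → ℕ) (X : Type) : Type
  | leaf (x : X) : HTree ar X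
  | node (a : V) (branch : Fin (ar a) → HTree ar X) : HTree ar X

namespace HTree

variable {U V W : Type} {ar : V → ℕ} {ar' : W → ℕ} {ar'' : U → ℕ} {X Y Z : Type}

/-- The marks of the vertices, in depth-first order. -/
def vertices : HTree ar X → List V
  | leaf _ => []
  | node a b => a :: (List.ofFn fun i => vertices (b i)).flatten

/-- The marks of the input leaves, in planar order. -/
def leaves : HTree ar X → List X
  | leaf x => [x]
  | node _ b => (List.ofFn fun i => leaves (b i)).flatten

/-- Graft the root of the tree `k x` to each leaf marked by `x`. -/
def graft : HTree ar X → (X → HTree ar Y) → HTree ar Y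
  | leaf x, k => k x
  | node a b, k => node a fun i => graft (b i) k

/-- Insert the tree `σ a` into each vertex marked by `a`: the vertex is replaced by `σ a`, whose
`i`-th leaf (the leaf marked by `i`) is connected to whatever the `i`-th input of the vertex was
connected to. -/
def insert (σ : ∀ a : V, HTree ar' (Fin (ar a))) : HTree ar X → HTree ar' X
  | leaf x => leaf x
  | node a b => (σ a).graft fun i => insert σ (b i)

/-- The tree with exactly one vertex, with the leaves marked in planar order. -/
def corolla (ar : V → ℕ) (a : V) : HTree ar (Fin (ar a)) :=
  node a leaf

theorem graft_assoc (t : HTree ar X) (k : X → HTree ar Y) (l : Y → HTree ar Z) :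
    (t.graft k).graft l = t.graft fun x => (k x).graft l := by
  induction t with
  | leaf x => rfl
  | node a b ih => simp [graft, ih]

theorem graft_leaf (t : HTree ar X) : t.graft leaf = t := by
  induction t with
  | leaf x => rfl
  | node a b ih => simp [graft, ih]

theorem insert_graft (σ : ∀ a : V, HTree ar' (Fin (ar a))) (t : HTree ar X)
    (k : X → HTree ar Y) :
    (t.graft k).insert σ = (t.insert σ).graft fun x => (k x).insert σ := by
  induction t with
  | leaf x => rfl
  | node a b ih => simp [graft, insert, ih, graft_assoc]

theorem insert_insert (σ : ∀ a : V, HTree ar' (Fin (ar a)))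
    (τ : ∀ a : W, HTree ar'' (Fin (ar' a))) (t : HTree ar X) :
    (t.insert σ).insert τ = t.insert fun a => (σ a).insert τ := by
  induction t with
  | leaf x => rfl
  | node a b ih => simp [insert, insert_graft, ih]

theorem insert_corolla (t : HTree ar X) : t.insert (corolla ar) = t := by
  induction t with
  | leaf x => rfl
  | node a b ih => simp [insert, corolla, graft, ih]

theorem corolla_insert (σ : ∀ a : V, HTree ar' (Fin (ar a))) (a : V) :
    (corolla ar a).insert σ = σ a :=
  graft_leaf (σ a)

theorem leaves_graft (t : HTree ar X) (k : X → HTree ar Y) :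
    (t.graft k).leaves = t.leaves.flatMap fun x => (k x).leaves := by
  induction t with
  | leaf x => simp [graft, leaves]
  | node a b ih =>
    simp only [graft, leaves, ih, List.flatMap_def, List.map_flatten, List.map_ofFn,
      List.flatten_flatten]
    rfl

theorem leaves_insert (σ : ∀ a : V, HTree ar' (Fin (ar a)))
    (hσ : ∀ a, (σ a).leaves = List.finRange (ar a)) (t : HTree ar X) :
    (t.insert σ).leaves = t.leaves := by
  induction t with
  | leaf x => rfl
  | node a b ih =>
    simp [insert, leaves, leaves_graft, ih, hσ, List.flatMap_def, List.ofFn_eq_map]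

theorem leaves_corolla (a : V) : (corolla ar a).leaves = List.finRange (ar a) := by
  simp [corolla, leaves, List.ofFn_eq_map, ← List.flatMap_def]

theorem vertices_corolla (a : V) : (corolla ar a).vertices ≠ [] := by
  simp [corolla, vertices]

theorem vertices_graft (t : HTree ar X) (k : X → HTree ar Y) (ht : t.vertices ≠ []) :
    (t.graft k).vertices ≠ [] := by
  cases t with
  | leaf x => exact absurd rfl ht
  | node a b => simp [graft, vertices]

theorem vertices_insert (σ : ∀ a : V, HTree ar' (Fin (ar a)))
    (hσ : ∀ a, (σ a).vertices ≠ []) (t : HTree ar X) (ht : t.vertices ≠ []) :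
    (t.insert σ).vertices ≠ [] := by
  cases t with
  | leaf x => exact absurd rfl ht
  | node a b => exact vertices_graft _ _ (hσ a)

end HTree

/-! ## The category of planar operadic trees and insertions of subtrees -/

/-- A non-unital operation of the operad `pOp` of planar operads: a planar rooted tree with
half-edges, with at least one vertex, with vertices indexed bijectively by `Fin numVertices`, and
with input leaves indexed in planar order. The inputs of the operation are the vertices: the input
indexed by `j` has colour `arity j`, and the output colour is `numLeaves`. -/
structure PlanarOperadicTree : Type where
  numVertices : ℕ
  numVertices_pos : 0 < numVertices
  /-- the number of input half-edges of each vertex -/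
  arity : Fin numVertices → ℕ
  tree : HTree arity ℕ
  /-- each vertex index is used at most once -/
  vertices_nodup : tree.vertices.Nodup
  /-- each vertex index is used -/
  mem_vertices : ∀ j, j ∈ tree.vertices
  numLeaves : ℕ
  leaves_eq : tree.leaves = List.range numLeaves

namespace PlanarOperadicTree

/-- A morphism `p ⟶ q`, i.e. a 2-level tree with lowest vertex marked by `p` and upper vertices
marked by non-unital operations `sub j` of `pOp`, whose composition is `q`. In other words, `q` is
obtained from `p` by insertion of a planar tree `sub j` with at least one vertex, and with
`p.arity j` leaves in planar order, into the `j`-th vertex of `p`, for all `j`.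

The vertices of `sub j` are marked by their indices in `q`; by `insert_eq` these marks are
distinct and the marks of all the trees `sub j` together partition the vertices of `q`. This
records both the indices of the leaves of the 2-level tree and the order on the vertices of the
operation `sub j`, which has to be the one induced from `q`, since the indices of the leaves above
each upper vertex of a 2-level tree increase in planar order. -/
@[ext]
structure Insertion (p q : PlanarOperadicTree) : Type where
  sub : ∀ j : Fin p.numVertices, HTree q.arity (Fin (p.arity j))
  sub_leaves : ∀ j, (sub j).leaves = List.finRange (p.arity j)
  sub_nonunital : ∀ j, (sub j).vertices ≠ []
  insert_eq : p.tree.insert sub = q.tree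

/-- The category `C(nupOp)ᵒᵖ`. -/
instance instCategory : SmallCategory PlanarOperadicTree where
  Hom := Insertion
  id p :=
    { sub := HTree.corolla p.arity
      sub_leaves := HTree.leaves_corolla
      sub_nonunital := HTree.vertices_corolla
      insert_eq := HTree.insert_corolla p.tree }
  comp {p q r} f g :=
    { sub := fun j => (f.sub j).insert g.sub
      sub_leaves := fun j => by rw [HTree.leaves_insert _ g.sub_leaves, f.sub_leaves]
      sub_nonunital := fun j => HTree.vertices_insert _ g.sub_nonunital _ (f.sub_nonunital j)
      insert_eq := by rw [← HTree.insert_insert, f.insert_eq, g.insert_eq] }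
  id_comp f := Insertion.ext (funext fun j => HTree.corolla_insert f.sub j)
  comp_id f := Insertion.ext (funext fun j => HTree.insert_corolla (f.sub j))
  assoc f g h := Insertion.ext (funext fun j => HTree.insert_insert g.sub h.sub (f.sub j))

end PlanarOperadicTree

/-! The category is itself Gröbner, so the identity functor suffices.

(G2) A morphism from `p` is a tuple of trees, one for each vertex of `p`, with prescribed leaves. By
Kruskal's theorem and finite products of well-quasi-orders, some tuple embeds componentwise in a
later one. Corresponding trees have equally many leaves, so whatever an embedding misses carries no
leaf and can be absorbed into trees inserted at the vertices of the smaller tree (`Embeds.refines`).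
Vertices of the target being distinct, these insertions form one morphism
(`Insertion.exists_comp_eq`).

(G1) To `f : p ⟶ q` belongs the word listing, over the vertices of `q` in depth-first order, the
vertices of `p` they come from. It determines `f`, and words are compared lexicographically. In the
word of `g : q ⟶ r` the vertices of `q` first occur in depth-first order
(`Insertion.firstOcc_word`). Hence the words of `f ≫ g` and `f' ≫ g` first differ where the vertex
of `q` at which those of `f` and `f'` first differ first occurs, and in the same two letters. -/

/-! ### Kruskal's theorem for planar trees -/

namespace HTree

variable {U V W X Y : Type} {ar : V → ℕ} {ar' : W → ℕ} {ar'' : U → ℕ}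

/-- The planar Kruskal embedding relation between trees: a vertex is sent to a vertex, the branches
above it being sent in planar order into some of the branches above its image. -/
inductive Embeds : HTree ar X → HTree ar' X → Prop
  | leaf (x : X) : Embeds (leaf x) (leaf x)
  | dive {s : HTree ar X} {a : W} (b : Fin (ar' a) → HTree ar' X) (i : Fin (ar' a)) :
      Embeds s (b i) → Embeds s (node a b)
  | node {a : V} {b : Fin (ar a) → HTree ar X} {a' : W} {b' : Fin (ar' a') → HTree ar' X}
      (φ : Fin (ar a) ↪o Fin (ar' a')) :
      (∀ i, Embeds (b i) (b' (φ i))) → Embeds (node a b) (node a' b')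

theorem Embeds.refl (t : HTree ar X) : Embeds t t := by
  induction t with
  | leaf x => exact .leaf x
  | node a b ih => exact .node (RelEmbedding.refl _) ih

theorem Embeds.trans {t : HTree ar' X} {r : HTree ar'' X} (h : Embeds t r) {s : HTree ar X}
    (h' : Embeds s t) : Embeds s r := by
  induction h generalizing s with
  | leaf x =>
    cases h'
    exact .leaf x
  | dive b i _ ih => exact .dive b i (ih h')
  | node φ _ ih =>
    cases h' with
    | dive _ i h => exact .dive _ (φ i) (ih i h)
    | node ψ h => exact .node (ψ.trans φ) fun i => ih (ψ i) (h i)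

/-- The planar trees with leaves marked by `X` and with vertices marked by any type. -/
structure AnyTree (X : Type) : Type 1 where
  Vertex : Type
  ar : Vertex → ℕ
  tree : HTree ar X

/-- The planar Kruskal embedding relation on `AnyTree X`. -/
def AnyTree.Embeds (s t : AnyTree X) : Prop :=
  HTree.Embeds s.tree t.tree

instance : IsPreorder (AnyTree X) AnyTree.Embeds where
  refl t := HTree.Embeds.refl t.tree
  trans _ _ _ h h' := HTree.Embeds.trans h' h

/-- The branches above the root vertex. -/
def AnyTree.branches : AnyTree X → List (AnyTree X)
  | ⟨_, _, .leaf _⟩ => []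
  | ⟨V, ar, .node _ b⟩ => List.ofFn fun i => ⟨V, ar, b i⟩

/-- The number of vertices. -/
def AnyTree.size (t : AnyTree X) : ℕ :=
  t.tree.vertices.length

/-- The mark of a tree without vertices. -/
def AnyTree.mark : AnyTree X → Option X
  | ⟨_, _, .leaf x⟩ => some x
  | ⟨_, _, .node _ _⟩ => none

/-- A leaf and a vertex without inputs both have no branches; the marks tell them apart. -/
theorem AnyTree.Embeds.of_branches {s t : AnyTree X} (hm : s.mark = t.mark)
    (h : List.SublistForall₂ AnyTree.Embeds s.branches t.branches) : s.Embeds t := by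
  obtain ⟨V, ar, s⟩ := s
  obtain ⟨W, ar', t⟩ := t
  cases s with
  | leaf x =>
    cases t with
    | leaf y =>
      obtain rfl : x = y := by simpa [mark] using hm
      exact .leaf x
    | node a b => simp [mark] at hm
  | node a b =>
    cases t with
    | leaf y => simp [mark] at hm
    | node a' b' =>
      obtain ⟨l, hl, hs⟩ := List.sublistForall₂_iff.1 h
      obtain ⟨f, hf⟩ := List.sublist_iff_exists_fin_orderEmbedding_get_eq.1 hs
      have hlen : ar a = l.length := by simpa [branches] using hl.length_eq
      have hlen' : (branches ⟨W, ar', .node a' b'⟩).length = ar' a' := by simp [branches]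
      refine .node (((Fin.castOrderIso hlen).toOrderEmbedding.trans f).trans
        (Fin.castOrderIso hlen').toOrderEmbedding) fun i => ?_
      have := hl.get (i := i) (by simp [branches]) (by simp [← hlen])
      have h2 := hf (Fin.cast hlen i)
      simp only [List.get_eq_getElem, Fin.val_cast] at h2
      simp only [List.get_eq_getElem, h2, branches, List.getElem_ofFn] at this
      exact this

theorem AnyTree.exists_branch {s c : AnyTree X} (h : c ∈ s.branches) :
    c.size < s.size ∧ ∀ r : AnyTree X, r.Embeds c → r.Embeds s := by
  obtain ⟨V, ar, s⟩ := s
  cases s with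
  | leaf x => simp [branches] at h
  | node a b =>
    obtain ⟨i, rfl⟩ : ∃ i, (⟨V, ar, b i⟩ : AnyTree X) = c := by
      simpa [branches, List.mem_ofFn'] using h
    refine ⟨?_, fun r hr => .dive b i hr⟩
    have : (b i).vertices.Sublist (List.ofFn fun i => vertices (b i)).flatten :=
      List.sublist_flatten_of_mem (by simp [List.mem_ofFn'])
    simpa [size, vertices, Nat.lt_succ_iff] using this.length_le

/-- **Kruskal's tree theorem** for planar trees with leaves marked by a finite type. -/
theorem AnyTree.partiallyWellOrderedOn_embeds [Finite X] :
    (Set.univ : Set (AnyTree X)).PartiallyWellOrderedOn AnyTree.Embeds := by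
  rw [Set.PartiallyWellOrderedOn.iff_not_exists_isMinBadSeq AnyTree.size]
  rintro ⟨f, hf, hmin⟩
  -- Nash-Williams' argument: a bad sequence of branches would contradict the minimality of `f`.
  have hbranch : {c | ∃ n, c ∈ (f n).branches}.PartiallyWellOrderedOn AnyTree.Embeds := by
    rw [Set.PartiallyWellOrderedOn.iff_forall_not_isBadSeq]
    rintro c ⟨hc, hbad⟩
    choose ν hν using hc
    obtain ⟨k, hk⟩ : ∃ k, ∀ l, ν k ≤ ν l :=
      -- The bad sequence is spliced into `f` at the least index `ν k`, so that every branch used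
      -- comes from a term of `f` at or after the splice.
      ⟨_, fun l => Function.argmin_le ν l⟩
    refine hmin (ν k) (fun m => if m < ν k then f m else c (k + (m - ν k)))
      (fun m hm => (if_pos hm).symm) ?_ ⟨fun _ => trivial, fun m n hmn => ?_⟩
    · simpa using (exists_branch (hν k)).1
    · by_cases hn : n < ν k
      · simpa [hn, hmn.trans hn] using hf.2 m n hmn
      · by_cases hm : m < ν k
        · simp only [hm, hn, if_true, if_false]
          exact fun h => hf.2 m _ (hm.trans_le (hk _)) ((exists_branch (hν _)).2 _ h)
        · simp only [hm, hn, if_false]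
          exact hbad _ _ (by omega)
  have : IsPreorder (List (AnyTree X)) (List.SublistForall₂ AnyTree.Embeds) := {}
  -- Higman's lemma for the lists of branches.
  obtain ⟨g, hg⟩ :=
    (Set.PartiallyWellOrderedOn.partiallyWellOrderedOn_sublistForall₂ _ hbranch).exists_monotone_subseq
      (f := fun n => (f n).branches) fun n c hc => ⟨n, hc⟩
  obtain ⟨m, n, hmn, h⟩ := Finite.exists_ne_map_eq_of_infinite fun n => (f (g n)).mark
  wlog hlt : m < n generalizing m n
  · exact this n m hmn.symm h.symm (lt_of_le_of_ne (not_lt.1 hlt) hmn.symm)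
  exact hf.2 _ _ (g.strictMono hlt) (.of_branches h (hg m n hlt.le))

end HTree

/-! ### From embeddings to insertions -/

namespace HTree

variable {U V W X Y : Type} {ar : V → ℕ} {ar' : W → ℕ} {ar'' : U → ℕ}

/-- Allows a branch missed by an embedding to become part of an inserted tree. -/
theorem exists_graft_eq_of_leaves_eq_nil (Y : Type) (t : HTree ar X) (ht : t.leaves = []) :
    ∃ s : HTree ar Y, s.leaves = [] ∧ ∀ k, s.graft k = t := by
  induction t with
  | leaf x => simp [leaves] at ht
  | node a b ih =>
    have hb : ∀ i, (b i).leaves = [] := by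
      simpa [leaves, List.flatten_eq_nil_iff, List.mem_ofFn'] using ht
    choose s hs hk using fun i => ih i (hb i)
    exact ⟨node a s, by simp [leaves, hs], fun k => by simp [graft, hk]⟩

theorem length_leaves_node (a : V) (b : Fin (ar a) → HTree ar X) :
    (node a b).leaves.length = ∑ i, (b i).leaves.length := by
  simp [leaves, List.length_flatten, List.map_ofFn, List.sum_ofFn]

theorem Embeds.length_leaves_le {s : HTree ar X} {t : HTree ar' X} (h : Embeds s t) :
    s.leaves.length ≤ t.leaves.length := by
  induction h with
  | leaf x => simp [leaves]
  | dive b i _ ih =>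
    rw [length_leaves_node]
    exact ih.trans (Finset.single_le_sum (f := fun i => (b i).leaves.length)
      (fun _ _ => Nat.zero_le _) (Finset.mem_univ i))
  | @node a b a' b' φ _ ih =>
    rw [length_leaves_node, length_leaves_node]
    refine (Finset.sum_le_sum fun i _ => ih i).trans ?_
    rw [← Finset.sum_image (f := fun j => (b' j).leaves.length) φ.injective.injOn]
    exact Finset.sum_le_sum_of_subset (Finset.subset_univ _)

/-- `Refines P s t` if `t` is obtained from `s` by inserting into each vertex marked by `a` a tree
`T` such that `P a T`. Different trees may be inserted into vertices with the same mark. -/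
inductive Refines (P : ∀ a : V, HTree ar' (Fin (ar a)) → Prop) : HTree ar X → HTree ar' X → Prop
  | leaf (x : X) : Refines P (leaf x) (leaf x)
  | node {a : V} {b : Fin (ar a) → HTree ar X} (T : HTree ar' (Fin (ar a)))
      (k : Fin (ar a) → HTree ar' X) :
      P a T → (∀ i, Refines P (b i) (k i)) → Refines P (node a b) (T.graft k)

/-- A tree with at least one vertex and with leaves marked in planar order can be inserted into a
vertex. -/
def Insertable (ar : V → ℕ) (a : V) (T : HTree ar' (Fin (ar a))) : Prop :=
  T.leaves = List.finRange (ar a) ∧ T.vertices ≠ []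

theorem Refines.mono {P Q : ∀ a : V, HTree ar' (Fin (ar a)) → Prop} (hPQ : ∀ a T, P a T → Q a T)
    {s : HTree ar X} {t : HTree ar' X} (h : Refines P s t) : Refines Q s t := by
  induction h with
  | leaf x => exact .leaf x
  | node T k hT _ ih => exact .node T k (hPQ _ _ hT) ih

theorem Refines.insert_eq {P : ∀ a : V, HTree ar' (Fin (ar a)) → Prop}
    {σ : ∀ a : V, HTree ar' (Fin (ar a))} (hσ : ∀ a T, P a T → T = σ a)
    {s : HTree ar X} {t : HTree ar' X} (h : Refines P s t) : s.insert σ = t := by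
  induction h with
  | leaf x => rfl
  | node T k hT _ ih => simp [insert, ih, hσ _ _ hT]

theorem Refines.exists_of_mem {P : ∀ a : V, HTree ar' (Fin (ar a)) → Prop}
    {s : HTree ar X} {t : HTree ar' X} (h : Refines P s t) {a : V} (ha : a ∈ s.vertices) :
    ∃ T, P a T := by
  induction h with
  | leaf x => simp [vertices] at ha
  | node T k hT _ ih =>
    simp only [vertices, List.mem_cons, List.mem_flatten, List.mem_ofFn'] at ha
    obtain rfl | ⟨_, ⟨i, rfl⟩, ha⟩ := ha
    · exact ⟨T, hT⟩
    · exact ih i ha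

theorem _root_.List.eq_of_mem_of_nodup_flatten_ofFn {α : Type*} {n : ℕ} {L : Fin n → List α}
    (h : (List.ofFn L).flatten.Nodup) {x : α} {i j : Fin n} (hi : x ∈ L i) (hj : x ∈ L j) :
    i = j := by
  have h' := (List.nodup_flatten.1 h).2
  rw [List.pairwise_ofFn] at h'
  by_contra hij
  rcases lt_or_gt_of_ne hij with hij | hij
  · exact h' hij hi hj
  · exact h' hij hj hi

/-- Only the choices actually made are kept; distinct marks prevent two of them from conflicting. -/
theorem Refines.exists_functional {Q : ∀ a : V, HTree ar' (Fin (ar a)) → Prop}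
    {s : HTree ar X} {t : HTree ar' X} (h : Refines Q s t) (hs : s.vertices.Nodup) :
    ∃ P : ∀ a : V, HTree ar' (Fin (ar a)) → Prop, Refines P s t ∧
      (∀ a T, P a T → Q a T ∧ a ∈ s.vertices) ∧ ∀ a T T', P a T → P a T' → T = T' := by
  induction h with
  | leaf x => exact ⟨fun _ _ => False, .leaf x, by simp, by simp⟩
  | @node a b T k hT _ ih =>
    simp only [vertices, List.nodup_cons] at hs
    obtain ⟨ha, hb⟩ := hs
    have hb' : ∀ i, (b i).vertices.Nodup := fun i =>
      (List.nodup_flatten.1 hb).1 _ (by simp [List.mem_ofFn'])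
    have hmem : ∀ {a' i}, a' ∈ (b i).vertices →
        a' ∈ (List.ofFn fun i => (b i).vertices).flatten := fun {a' i} h =>
      List.mem_flatten.2 ⟨_, List.mem_ofFn.2 ⟨i, rfl⟩, h⟩
    choose P hP hQ hf using fun i => ih i (hb' i)
    -- Equality of pairs avoids transporting `T'` along `a' = a`.
    refine ⟨fun a' T' => (⟨a', T'⟩ : Σ a, HTree ar' (Fin (ar a))) = ⟨a, T⟩ ∨ ∃ i, P i a' T',
      .node T k (.inl rfl) fun i => (hP i).mono fun a' T' h => .inr ⟨i, h⟩, ?_, ?_⟩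
    · rintro a' T' (h | ⟨i, h⟩)
      · cases h
        exact ⟨hT, by simp [vertices]⟩
      · exact ⟨(hQ i _ _ h).1, List.mem_cons_of_mem _ (hmem (hQ i _ _ h).2)⟩
    · rintro a' T₁ T₂ (h₁ | ⟨i, h₁⟩) (h₂ | ⟨j, h₂⟩)
      · exact eq_of_heq (Sigma.mk.inj (h₁.trans h₂.symm)).2
      · cases h₁
        exact absurd (hmem (hQ j _ _ h₂).2) ha
      · cases h₂
        exact absurd (hmem (hQ i _ _ h₁).2) ha
      · obtain rfl := List.eq_of_mem_of_nodup_flatten_ofFn hb (hQ i _ _ h₁).2 (hQ j _ _ h₂).2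
        exact hf i _ _ _ h₁ h₂

theorem _root_.List.flatten_ofFn_eq_finRange {m n : ℕ} (φ : Fin n ↪o Fin m)
    {L : Fin m → List (Fin n)} (hL : ∀ j, (L j).Pairwise (· < ·))
    (hmem : ∀ j i, i ∈ L j ↔ φ i = j) : (List.ofFn L).flatten = List.finRange n := by
  refine List.Perm.eq_of_pairwise' (r := (· < ·)) ?_ (List.pairwise_lt_finRange n) ?_
  · rw [List.pairwise_flatten, List.pairwise_ofFn]
    refine ⟨fun l hl => ?_, fun j j' hj i hi i' hi' => ?_⟩
    · obtain ⟨j, rfl⟩ := List.mem_ofFn.1 hl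
      exact hL j
    · rw [hmem] at hi hi'
      rw [← φ.lt_iff_lt, hi, hi']
      exact hj
  · refine (List.perm_ext_iff_of_nodup ?_ (List.nodup_finRange n)).2 fun i => ?_
    · rw [List.nodup_flatten, List.pairwise_ofFn]
      refine ⟨fun l hl => ?_, fun j j' hj i hi hi' => ?_⟩
      · obtain ⟨j, rfl⟩ := List.mem_ofFn.1 hl
        exact (hL j).imp ne_of_lt
      · rw [hmem] at hi hi'
        exact hj.ne (hi.symm.trans hi')
    · simp only [List.mem_flatten, List.mem_ofFn', List.mem_finRange, iff_true]
      exact ⟨_, ⟨φ i, rfl⟩, (hmem _ _).2 rfl⟩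

/-- A branch hit by `φ` contributes one leaf, marked by its preimage, and the others none; as `φ` is
increasing, the leaves appear in planar order. -/
theorem exists_graft_eq_of_fiberwise {m n : ℕ} (φ : Fin n ↪o Fin m) (b : Fin m → HTree ar X)
    (k : Fin n → HTree ar X)
    (h : ∀ i, ∃ u : HTree ar (Fin 1), u.leaves = [0] ∧
      u.graft (fun _ => k i) = b (φ i))
    (h' : ∀ j, (∀ i, φ i ≠ j) → (b j).leaves = []) :
    ∃ T : Fin m → HTree ar (Fin n),
      (List.ofFn fun j => (T j).leaves).flatten = List.finRange n ∧ ∀ j, (T j).graft k = b j := by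
  have key : ∀ j, ∃ T : HTree ar (Fin n), (T.leaves.Pairwise (· < ·) ∧
      ∀ i, i ∈ T.leaves ↔ φ i = j) ∧ T.graft k = b j := by
    intro j
    by_cases hj : ∃ i, φ i = j
    · obtain ⟨i, rfl⟩ := hj
      obtain ⟨u, hu, hk⟩ := h i
      refine ⟨u.graft fun _ => leaf i, ?_, ?_⟩
      · simp [leaves_graft, hu, leaves, eq_comm]
      · rw [graft_assoc, ← hk]
        rfl
    · push Not at hj
      obtain ⟨T, hT, hk⟩ := exists_graft_eq_of_leaves_eq_nil (Fin n) (b j) (h' j hj)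
      exact ⟨T, by simp [hT, hj], hk k⟩
  choose T hT hk using key
  exact ⟨T, List.flatten_ofFn_eq_finRange φ (fun j => (hT j).1) fun j => (hT j).2, hk⟩

/-- Here `u` is the part of `t` below the image of the root of `s`, with its leafless side branches.
It is kept apart because only a vertex of the source can absorb it, and `s` may be a leaf. -/
theorem Embeds.exists_refines {s : HTree ar X} {t : HTree ar' X} (h : Embeds s t)
    (hl : t.leaves.length ≤ s.leaves.length) :
    ∃ (u : HTree ar' (Fin 1)) (t' : HTree ar' X), u.leaves = [0] ∧
      u.graft (fun _ => t') = t ∧ Refines (Insertable ar) s t' := by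
  induction h with
  | leaf x => exact ⟨HTree.leaf 0, HTree.leaf x, by simp [leaves], rfl, .leaf x⟩
  | @dive s a b i h ih =>
    have hsum := length_leaves_node a b
    rw [← Finset.add_sum_erase _ _ (Finset.mem_univ i)] at hsum
    have hle := h.length_leaves_le
    obtain ⟨u, t', hu, ht, hr⟩ := ih (by omega)
    have h0 : ∑ j ∈ Finset.univ.erase i, (b j).leaves.length = 0 := by omega
    obtain ⟨T, hT, hk⟩ := exists_graft_eq_of_fiberwise
      (OrderEmbedding.ofStrictMono (fun _ : Fin 1 => i) fun i j h =>
        absurd h (by simp [Subsingleton.elim i j])) b (fun _ => t') (fun _ => ⟨u, hu, ht⟩)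
      fun j hj => by
        rw [Finset.sum_eq_zero_iff] at h0
        exact List.length_eq_zero_iff.1 
          (h0 j (Finset.mem_erase.2 ⟨fun h => hj 0 h.symm, Finset.mem_univ j⟩))
    exact ⟨HTree.node a T, t', hT, by simp [graft, hk], hr⟩
  | @node a b a' b' φ h ih =>
    have hle := fun i => (h i).length_leaves_le
    rw [length_leaves_node, length_leaves_node,
      ← Finset.sum_add_sum_compl (Finset.univ.image φ),
      Finset.sum_image φ.injective.injOn] at hl
    have hle' := Finset.sum_le_sum fun i (_ : i ∈ Finset.univ) => hle i
    have h0 : ∑ j ∈ (Finset.univ.image φ)ᶜ, (b' j).leaves.length = 0 := by omega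
    -- Equal totals force the termwise inequalities to be equalities.
    have heq := (Finset.sum_eq_sum_iff_of_le fun i (_ : i ∈ Finset.univ) => hle i).1 (by omega)
    choose u t' hu ht hr using fun i => ih i (heq i (Finset.mem_univ i)).ge
    obtain ⟨T, hT, hk⟩ := exists_graft_eq_of_fiberwise φ b' t' (fun i => ⟨u i, hu i, ht i⟩)
      fun j hj => by
        rw [Finset.sum_eq_zero_iff] at h0
        exact List.length_eq_zero_iff.1 (h0 j (by simpa using hj))
    -- The tree inserted at the root consists of `a'`, the parts `u i` and the leafless branches.
    refine ⟨HTree.leaf 0, (HTree.node a' T).graft t', by simp [leaves], by simp [graft, hk], ?_⟩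
    exact .node _ t' ⟨hT, by simp [vertices]⟩ hr

theorem vertices_graft_of_leaves_ne_nil (u : HTree ar X) (k : X → HTree ar Y) (x : X)
    (hx : x ∈ u.leaves) (hk : (k x).vertices ≠ []) : (u.graft k).vertices ≠ [] := by
  cases u with
  | leaf y => simp_all [leaves, graft]
  | node a b => simp [graft, vertices]

/-- The remaining part `u` is absorbed by the tree inserted at the root of `s`, which therefore must
be a vertex. -/
theorem Embeds.refines {s : HTree ar X} {t : HTree ar' X} (h : Embeds s t)
    (hl : t.leaves.length ≤ s.leaves.length) (hs : s.vertices ≠ []) :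
    Refines (Insertable ar) s t := by
  obtain ⟨u, t', hu, rfl, hr⟩ := h.exists_refines hl
  cases hr with
  | leaf x => exact absurd rfl hs
  | @node a b T k hT hr =>
    rw [← graft_assoc]
    refine .node _ k ⟨?_, ?_⟩ hr
    · simp [leaves_graft, hu, hT.1]
    · exact vertices_graft_of_leaves_ne_nil u _ 0 (by simp [hu]) hT.2

end HTree

/-! ### Vertices of grafted and inserted trees -/

namespace HTree

variable {U V W X Y : Type} {ar : V → ℕ} {ar' : W → ℕ} {ar'' : U → ℕ}

theorem _root_.List.flatten_ofFn_append_perm {α : Type*} {n : ℕ} (L M : Fin n → List α) :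
    (List.ofFn fun i => L i ++ M i).flatten.Perm ((List.ofFn L).flatten ++ (List.ofFn M).flatten) := by
  simp only [List.ofFn_eq_map, ← List.flatMap_def]
  exact (List.flatMap_append_perm _ L M).symm

theorem _root_.List.flatten_ofFn_perm {α : Type*} {n : ℕ} {L M : Fin n → List α}
    (h : ∀ i, (L i).Perm (M i)) : (List.ofFn L).flatten.Perm (List.ofFn M).flatten := by
  simp only [List.ofFn_eq_map, ← List.flatMap_def]
  exact List.Perm.flatMap_left _ fun i _ => h i

theorem vertices_graft_perm (t : HTree ar X) (k : X → HTree ar Y) :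
    (t.graft k).vertices.Perm (t.vertices ++ t.leaves.flatMap fun x => (k x).vertices) := by
  induction t with
  | leaf x => simp [graft, vertices, leaves]
  | node a b ih =>
    have h : (node a b).leaves.flatMap (fun x => (k x).vertices) =
        (List.ofFn fun i => (b i).leaves.flatMap fun x => (k x).vertices).flatten := by
      simp only [leaves, List.flatMap_def, List.map_flatten, List.map_ofFn, List.flatten_flatten]
      rfl
    rw [h]
    simp only [graft, vertices, List.cons_append]
    exact ((List.flatten_ofFn_perm ih).trans (List.flatten_ofFn_append_perm _ _)).cons a

theorem vertices_insert_perm (σ : ∀ a : V, HTree ar' (Fin (ar a)))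
    (hσ : ∀ a, (σ a).leaves = List.finRange (ar a)) (t : HTree ar X) :
    (t.insert σ).vertices.Perm (t.vertices.flatMap fun a => (σ a).vertices) := by
  induction t with
  | leaf x => simp [insert, vertices]
  | node a b ih =>
    have h := vertices_graft_perm (σ a) fun i => insert σ (b i)
    rw [hσ] at h
    refine (h.trans (List.Perm.append_left _ (List.Perm.flatMap_left _ fun i _ => ih i))).trans
      (List.Perm.of_eq ?_)
    simp only [vertices, List.flatMap_def, List.ofFn_eq_map, List.map_cons, List.flatten_cons,
      List.map_flatten, List.map_map, List.flatten_flatten]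
    rfl

end HTree

/-! ### The Noetherian condition (G2) -/

namespace PlanarOperadicTree

open HTree

variable {p q r : PlanarOperadicTree}

theorem vertices_perm (p : PlanarOperadicTree) :
    p.tree.vertices.Perm (List.finRange p.numVertices) :=
  (List.perm_ext_iff_of_nodup p.vertices_nodup (List.nodup_finRange _)).2 fun j => by
    simp [p.mem_vertices]

theorem Insertion.vertices_perm (f : Insertion p q) :
    (List.ofFn fun j => (f.sub j).vertices).flatten.Perm q.tree.vertices := by
  rw [← f.insert_eq, List.ofFn_eq_map, ← List.flatMap_def]
  exact ((vertices_insert_perm f.sub f.sub_leaves p.tree).trans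
    (p.vertices_perm.flatMap_right _)).symm

theorem Insertion.nodup (f : Insertion p q) :
    (List.ofFn fun j => (f.sub j).vertices).flatten.Nodup :=
  f.vertices_perm.nodup_iff.2 q.vertices_nodup

theorem Insertion.exists_mem (f : Insertion p q) (v : Fin q.numVertices) :
    ∃ j, v ∈ (f.sub j).vertices := by
  simpa [List.mem_ofFn'] using f.vertices_perm.mem_iff.2 (q.mem_vertices v)

/-- Each vertex of `q` lies in exactly one `f.sub j`, so the partial functions obtained for the
various `j` glue to a total one. -/
theorem Insertion.exists_comp_eq (f : Insertion p q) (g : Insertion p r)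
    (h : ∀ j, Embeds (f.sub j) (g.sub j)) :
    ∃ σ : Insertion q r, ∀ j, (f.sub j).insert σ.sub = g.sub j := by
  have hn : ∀ j, (f.sub j).vertices.Nodup := fun j =>
    (List.nodup_flatten.1 f.nodup).1 _ (by simp [List.mem_ofFn'])
  choose P hP hQ hf using fun j =>
    ((h j).refines (by simp [f.sub_leaves, g.sub_leaves]) (f.sub_nonunital j)).exists_functional
      (hn j)
  have hex : ∀ v, ∃ T, ∃ j, P j v T := fun v => by
    obtain ⟨j, hj⟩ := f.exists_mem v
    obtain ⟨T, hT⟩ := (hP j).exists_of_mem hj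
    exact ⟨T, j, hT⟩
  choose σ j hσ using hex
  have huniq : ∀ i v T, P i v T → T = σ v := fun i v T hT => by
    obtain rfl := List.eq_of_mem_of_nodup_flatten_ofFn f.nodup (hQ i v T hT).2 (hQ _ v _ (hσ v)).2
    exact hf _ _ _ _ hT (hσ v)
  have hcomp : ∀ j, (f.sub j).insert σ = g.sub j := fun j => (hP j).insert_eq (huniq j)
  refine ⟨⟨σ, fun v => (hQ _ v _ (hσ v)).1.1, fun v => (hQ _ v _ (hσ v)).1.2, ?_⟩, hcomp⟩
  rw [← f.insert_eq, insert_insert, funext hcomp, g.insert_eq]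

theorem isNoetherianPoset_underPoset (p : PlanarOperadicTree) :
    IsNoetherianPoset (UnderPoset p) := by
  intro x
  let f : ∀ n, Insertion p (ofAntisymmetrization _ (x n)).target := fun n =>
    (ofAntisymmetrization _ (x n)).hom
  have hwqo := WellQuasiOrdered.pi fun j : Fin p.numVertices =>
    Set.partiallyWellOrderedOn_univ_iff.1
      (AnyTree.partiallyWellOrderedOn_embeds (X := Fin (p.arity j)))
  obtain ⟨m, n, hmn, h⟩ := hwqo fun n j => ⟨_, _, (f n).sub j⟩
  obtain ⟨σ, hσ⟩ := (f m).exists_comp_eq (f n) h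
  refine ⟨m, n, hmn, ?_⟩
  rw [← ofAntisymmetrization_le_ofAntisymmetrization_iff]
  exact ⟨σ, Insertion.ext (funext hσ)⟩

end PlanarOperadicTree

/-! ### First occurrences and lexicographic comparison -/

/-- `List.FirstOcc E M L` if the elements of `L` outside `E` have their first occurrences in the
order in which they are listed in `M`. -/
inductive List.FirstOcc {α : Type*} : Set α → List α → List α → Prop
  | nil (E : Set α) : FirstOcc E [] []
  | skip {E : Set α} {M L : List α} {x : α} : x ∈ E → FirstOcc E M L → FirstOcc E M (x :: L)
  | cons {E : Set α} {M L : List α} (x : α) :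
      FirstOcc (Insert.insert x E) M L → FirstOcc E (x :: M) (x :: L)

namespace List.FirstOcc

variable {α : Type*} {E F : Set α} {M M' L L' : List α}

theorem mono (h : FirstOcc E M L) (hEF : E ⊆ F) : FirstOcc F M L := by
  induction h generalizing F with
  | nil => exact .nil F
  | skip hx _ ih => exact .skip (hEF hx) (ih hEF)
  | cons x _ ih => exact .cons x (ih (Set.insert_subset_insert hEF))

theorem append (h : FirstOcc E M L) (h' : FirstOcc E M' L') : FirstOcc E (M ++ M') (L ++ L') := by
  induction h with
  | nil => exact h'
  | skip hx _ ih => exact .skip hx (ih h')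
  | cons x _ ih => exact .cons x (ih (h'.mono (Set.subset_insert _ _)))

theorem flatten_ofFn {n : ℕ} {M L : Fin n → List α} (h : ∀ i, FirstOcc E (M i) (L i)) :
    FirstOcc E (List.ofFn M).flatten (List.ofFn L).flatten := by
  induction n with
  | zero => simpa using FirstOcc.nil E
  | succ n ih =>
    simp only [List.ofFn_succ, List.flatten_cons]
    exact (h 0).append (ih fun i => h i.succ)

/-- Skipped letters agree by `hE`. At a new letter either the comparison is decided, or the values
agree and the letter joins `E`. -/
theorem map_lt_map {β : Type*} [LinearOrder β] {f f' : α → β} (h : FirstOcc E M L)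
    (hE : ∀ x ∈ E, f x = f' x) (hlt : M.map f < M.map f') : L.map f < L.map f' := by
  induction h with
  | nil => exact hlt
  | skip hx _ ih =>
    rw [List.map_cons, List.map_cons, hE _ hx, List.cons_lt_cons_self]
    exact ih hE hlt
  | cons x _ ih =>
    rw [List.map_cons, List.map_cons, List.cons_lt_cons_iff] at hlt ⊢
    refine hlt.imp_right fun ⟨hx, hlt⟩ => ⟨hx, ih ?_ hlt⟩
    rintro y (rfl | hy)
    · exact hx
    · exact hE y hy

end List.FirstOcc

/-! ### Owners of vertices determine an insertion -/

namespace HTree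

variable {V W X Y : Type} {ar : V → ℕ} {ar' : W → ℕ}

theorem firstOcc_graft {o : V → Y} {E : Set Y} {M : X → List Y} (s : HTree ar X)
    {Z : Type} (k : X → HTree ar Z) (hs : ∀ v ∈ s.vertices, o v ∈ E)
    (hk : ∀ x, List.FirstOcc E (M x) ((k x).vertices.map o)) :
    List.FirstOcc E (s.leaves.flatMap M) ((s.graft k).vertices.map o) := by
  induction s with
  | leaf x => simpa [leaves, graft] using hk x
  | node a b ih =>
    simp only [vertices, List.mem_cons, forall_eq_or_imp] at hs
    refine .skip hs.1 ?_
    simp only [leaves, List.flatMap_def, List.map_flatten, List.map_ofFn, List.flatten_flatten]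
    exact .flatten_ofFn fun i => ih i fun v hv =>
      hs.2 v (List.mem_flatten.2 ⟨_, List.mem_ofFn.2 ⟨i, rfl⟩, hv⟩)

/-- The root of `σ a` comes first and is the first occurrence of `a`; its other vertices only repeat
`a`, and the branches follow in the planar order of the leaves of `σ a`. -/
theorem firstOcc_insert {σ : ∀ a : V, HTree ar' (Fin (ar a))}
    (hσ : ∀ a, (σ a).leaves = List.finRange (ar a)) (hne : ∀ a, (σ a).vertices ≠ [])
    {o : W → V} (ho : ∀ a, ∀ v ∈ (σ a).vertices, o v = a) (t : HTree ar X) (E : Set V) :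
    List.FirstOcc E t.vertices ((t.insert σ).vertices.map o) := by
  induction t generalizing E with
  | leaf x => exact .nil E
  | node a b ih =>
    have hl := hσ a
    have hv := ho a
    have h0 := hne a
    simp only [insert, vertices, List.ofFn_eq_map, ← List.flatMap_def]
    rw [← hl]
    generalize σ a = s at hl hv h0 ⊢
    cases s with
    | leaf x => exact absurd rfl h0
    | node c d =>
      simp only [vertices, List.mem_cons, forall_eq_or_imp] at hv
      simp only [graft, vertices, List.map_cons, hv.1]
      refine .cons a ?_
      simp only [leaves, List.flatMap_def, List.map_flatten, List.map_ofFn, List.flatten_flatten]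
      exact .flatten_ofFn fun i => firstOcc_graft _ _
        (fun v h => .inl (hv.2 v (List.mem_flatten.2 ⟨_, List.mem_ofFn.2 ⟨i, rfl⟩, h⟩)))
        fun j => ih j _

/-- The predicate `P` shows where to cut: `s` is the part at the root on which it holds. The trees
cut off are recorded as leaf marks. -/
theorem graft_leaf_eq_of_graft_eq {P : V → Prop} {s s' : HTree ar X} {k k' : X → HTree ar Y}
    (hs : ∀ v ∈ s.vertices, P v) (hs' : ∀ v ∈ s'.vertices, P v)
    (hk : ∀ x, ∀ v ∈ (k x).vertices, ¬ P v) (hk' : ∀ x, ∀ v ∈ (k' x).vertices, ¬ P v)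
    (h : s.graft k = s'.graft k') :
    s.graft (fun x => leaf (k x)) = s'.graft fun x => (leaf (k' x) : HTree ar (HTree ar Y)) := by
  induction s generalizing s' with
  | leaf x =>
    cases s' with
    | leaf y => exact congrArg leaf h
    | node a b =>
      have h : k x = _ := h
      exact absurd (hs' a (by simp [vertices])) (hk x a (by simp [h, graft, vertices]))
  | node a b ih =>
    cases s' with
    | leaf y =>
      have h : _ = k' y := h
      exact absurd (hs a (by simp [vertices])) (hk' y a (by simp [← h, graft, vertices]))
    | node a' b' =>
      simp only [graft, node.injEq] at h ⊢
      obtain ⟨rfl, h⟩ := h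
      simp only [vertices, List.mem_cons, forall_eq_or_imp] at hs hs'
      refine ⟨rfl, heq_of_eq (funext fun i => ih i ?_ ?_ (congrFun (eq_of_heq h) i))⟩
      · exact fun v hv => hs.2 v (List.mem_flatten.2 ⟨_, List.mem_ofFn.2 ⟨i, rfl⟩, hv⟩)
      · exact fun v hv => hs'.2 v (List.mem_flatten.2 ⟨_, List.mem_ofFn.2 ⟨i, rfl⟩, hv⟩)

theorem eq_of_graft_leaf_eq {s s' : HTree ar X} {k k' : X → Y}
    (h : s.graft (fun x => leaf (k x)) = s'.graft fun x => (leaf (k' x) : HTree ar Y))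
    (hl : s.leaves = s'.leaves) : s = s' := by
  induction s generalizing s' with
  | leaf x =>
    cases s' with
    | leaf y => simpa [leaves] using hl
    | node a b => simp [graft] at h
  | node a b ih =>
    cases s' with
    | leaf y => simp [graft] at h
    | node a' b' =>
      simp only [graft, node.injEq] at h
      obtain ⟨rfl, h⟩ := h
      have h := congrFun (eq_of_heq h)
      have hlen : ∀ i, (b i).leaves.length = (b' i).leaves.length := fun i => by
        simpa [leaves_graft, leaves] using congrArg (fun t => t.leaves.length) (h i)
      have hb : ∀ i, (b i).leaves = (b' i).leaves := congrFun (List.ofFn_injective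
        (List.eq_iff_flatten_eq.2 ⟨hl, by simp [List.map_ofFn, Function.comp_def, hlen]⟩))
      exact congrArg (node a) (funext fun i => ih i (h i) (hb i))

theorem eq_of_graft_eq {s : HTree ar X} {k k' : X → HTree ar Y} (h : s.graft k = s.graft k')
    {x : X} (hx : x ∈ s.leaves) : k x = k' x := by
  induction s with
  | leaf y =>
    obtain rfl : x = y := by simpa [leaves] using hx
    exact h
  | node a b ih =>
    simp only [graft, node.injEq, heq_eq_eq, true_and] at h
    simp only [leaves, List.mem_flatten, List.mem_ofFn'] at hx
    obtain ⟨_, ⟨i, rfl⟩, hx⟩ := hx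
    exact ih i (congrFun h i) hx

/-- At the root marked `c`, the tree `σ c` is cut out by the vertices with owner `c`; none occur
higher up, since `c` is not repeated in `t`. -/
theorem eq_of_insert_eq {σ σ' : ∀ a : V, HTree ar' (Fin (ar a))}
    (hσ : ∀ a, (σ a).leaves = List.finRange (ar a))
    (hσ' : ∀ a, (σ' a).leaves = List.finRange (ar a)) {o : W → V}
    (ho : ∀ a, ∀ v ∈ (σ a).vertices, o v = a) (ho' : ∀ a, ∀ v ∈ (σ' a).vertices, o v = a)
    {t : HTree ar X} (ht : t.vertices.Nodup) (h : t.insert σ = t.insert σ') {a : V}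
    (ha : a ∈ t.vertices) : σ a = σ' a := by
  induction t with
  | leaf x => simp [vertices] at ha
  | node c b ih =>
    simp only [vertices, List.nodup_cons] at ht
    have hmem : ∀ {v i}, v ∈ (b i).vertices →
        v ∈ (List.ofFn fun i => (b i).vertices).flatten := fun {v i} h =>
      List.mem_flatten.2 ⟨_, List.mem_ofFn.2 ⟨i, rfl⟩, h⟩
    have key : ∀ {τ : ∀ a : V, HTree ar' (Fin (ar a))},
        (∀ a, (τ a).leaves = List.finRange (ar a)) → (∀ a, ∀ v ∈ (τ a).vertices, o v = a) →
        ∀ i, ∀ v ∈ ((b i).insert τ).vertices, ¬ o v = c := fun hτ hoτ i v hv hvc => by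
      obtain ⟨d, hd, hv⟩ := List.mem_flatMap.1 ((vertices_insert_perm _ hτ _).mem_iff.1 hv)
      rw [hoτ d v hv] at hvc
      exact ht.1 (hvc ▸ hmem hd)
    have hc : σ c = σ' c := eq_of_graft_leaf_eq (graft_leaf_eq_of_graft_eq (P := fun v => o v = c)
      (ho c) (ho' c) (key hσ ho) (key hσ' ho') h) ((hσ c).trans (hσ' c).symm)
    simp only [vertices, List.mem_cons, List.mem_flatten, List.mem_ofFn'] at ha
    obtain rfl | ⟨_, ⟨i, rfl⟩, ha⟩ := ha
    · exact hc
    · simp only [insert, ← hc] at h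
      refine ih i ((List.nodup_flatten.1 ht.2).1 _ (by simp [List.mem_ofFn'])) ?_ ha
      exact eq_of_graft_eq h (x := i) (by simp [hσ])

end HTree

/-! ### The admissible order (G1) and the conclusion -/

namespace PlanarOperadicTree

open HTree

variable {p q r : PlanarOperadicTree}

/-- The index of the vertex of `p` into which the vertex `v` of `q` is inserted. -/
noncomputable def Insertion.owner (f : Insertion p q) (v : Fin q.numVertices) :
    Fin p.numVertices :=
  (f.exists_mem v).choose

theorem Insertion.owner_eq (f : Insertion p q) (j : Fin p.numVertices) (v : Fin q.numVertices)
    (hv : v ∈ (f.sub j).vertices) : f.owner v = j :=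
  List.eq_of_mem_of_nodup_flatten_ofFn f.nodup (f.exists_mem v).choose_spec hv

theorem Insertion.owner_injective : Function.Injective (Insertion.owner (p := p) (q := q)) :=
  fun f f' h => Insertion.ext (funext fun j =>
    eq_of_insert_eq f.sub_leaves f'.sub_leaves f.owner_eq (h ▸ f'.owner_eq) p.vertices_nodup
      (f.insert_eq.trans f'.insert_eq.symm) (p.mem_vertices j))

theorem Insertion.owner_comp (f : p ⟶ q) (g : q ⟶ r) (v : Fin r.numVertices) :
    Insertion.owner (f ≫ g) v = Insertion.owner f (Insertion.owner g v) := by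
  refine Insertion.owner_eq (f ≫ g) _ v ?_
  exact (vertices_insert_perm g.sub g.sub_leaves _).mem_iff.2 (List.mem_flatMap.2
    ⟨_, (Insertion.exists_mem f _).choose_spec, (Insertion.exists_mem g v).choose_spec⟩)

/-- The list of the owners of the vertices of `q` in depth-first order. -/
noncomputable def Insertion.word (f : Insertion p q) : List (Fin p.numVertices) :=
  q.tree.vertices.map f.owner

theorem Insertion.word_injective : Function.Injective (Insertion.word (p := p) (q := q)) :=
  fun _ _ h => owner_injective (funext fun v => List.map_inj_left.1 h v (q.mem_vertices v))

theorem Insertion.word_comp (f : p ⟶ q) (g : q ⟶ r) :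
    Insertion.word (f ≫ g) = (Insertion.word g).map (Insertion.owner f) := by
  simp [word, owner_comp]

theorem Insertion.firstOcc_word (g : Insertion q r) : List.FirstOcc ∅ q.tree.vertices g.word := by
  have h := firstOcc_insert g.sub_leaves g.sub_nonunital g.owner_eq q.tree ∅
  rwa [g.insert_eq] at h

instance : Finite (p ⟶ q) :=
  Finite.of_injective _ (Insertion.owner_injective (p := p) (q := q))

/-- Morphisms from `p` are compared lexicographically by their words. -/
noncomputable def admissibleOrder (p : PlanarOperadicTree) : AdmissibleOrder p where
  lt q f f' := Insertion.word f < Insertion.word f'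
  wellOrder q := by
    let := LinearOrder.lift' _ (Insertion.word_injective (p := p) (q := q))
    have : WellFoundedLT (p ⟶ q) := inferInstance
    exact isWellOrder_lt (α := p ⟶ q)
  strictMono g f f' h := by
    rw [Insertion.word_comp, Insertion.word_comp]
    exact (Insertion.firstOcc_word g).map_lt_map (by simp) h

theorem isGrobner : IsGrobner PlanarOperadicTree :=
  ⟨fun p => ⟨admissibleOrder p⟩, isNoetherianPoset_underPoset⟩

end PlanarOperadicTree

theorem propertyF_id (C : Type*) [Category C] : PropertyF (𝟭 C) :=
  fun d => ⟨1, fun _ => d, fun _ => 𝟙 d, fun _ h => ⟨0, h, (Category.id_comp h).symm⟩⟩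

theorem mainTheorem1 : IsQuasiGrobner PlanarOperadicTree :=
  ⟨PlanarOperadicTree, inferInstance, 𝟭 _, PlanarOperadicTree.isGrobner, inferInstance,
    propertyF_id _⟩
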